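/- Let $\lambda$ be a partition of $n$ and let $d$ be the number of dots on the main diagonal of its Ferrers graph. For $1\le i\le d$ let $x_i$ be the number of dots in row $i$ to the right of the $i$-th diagonal dot and $y_i$ the number of dots in column $i$ below it. The array $\begin{pmatrix} x_1 & \cdots & x_d\\ y_1 & \cdots & y_d\end{pmatrix}$ is the Frobenius symbol of $\lambda$, and we say that $\lambda$ has exactly $d$ columns (the $i$-th successive rank of $\lambda$ is $x_i-y_i$). A column is positive if $x_i-y_i\ge 1$ and negative if $x_i-y_i\le 0$; two columns have the same parity if both are positive or both are negative. The parity blocks of $\lambda$ are the maximal sets of contiguous columns having the same parity; a block is positive (negative) if its columns are positive (negative). For positive integers $d\ge m$, let $a^+_m(n;d)$ and $a^-_m(n;d)$ be the numbers of partitions of $n$ with exactly $d$ columns and exactly $m$ parity blocks, the last of which is positive, respectively negative. Write $(a;q)_n=\prod_{i=0}^{n-1}(1-aq^i)$ and $\begin{bmatrix} n\\ k\end{bmatrix}_q=\frac{(q;q)_n}{(q;q)_k(q;q)_{n-k}}$ for $n\ge k\ge 0$ (and $0$ otherwise). **Theorem.** For all integers $d\ge m\ge 1$, as formal power series in $q$,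 $$\sum_{n\ge 0} a^+_m(n;d)\,q^n=\frac{q^{d^2+d+\binom m2}}{(q;q)_{2d}}\,\frac{1-q^m}{1-q^d}\begin{bmatrix} 2d\\ d+m\end{bmatrix}_q$$ and $$\sum_{n\ge 0} a^-_m(n;d)\,q^n=\frac{q^{d^2+\binom m2}}{(q;q)_{2d}}\,\frac{1-q^m}{1-q^d}\begin{bmatrix} 2d\\ d+m\end{bmatrix}_q .$$ -/

import Mathlib

namespace ParityBlocks

/-- The number of dots in row `i` (counted from `0`, largest part first) of the Ferrers graph of
`p`; it is `0` if `p` has at most `i` parts. -/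
def rowLength {n : ℕ} (p : n.Partition) (i : ℕ) : ℕ :=
  (p.parts.sort (· ≥ ·)).getD i 0

/-- The number of dots in column `j` (counted from `0`) of the Ferrers graph of `p`, that is, the
number of parts greater than `j`. -/
def colLength {n : ℕ} (p : n.Partition) (j : ℕ) : ℕ :=
  p.parts.countP (fun k => j < k)

/-- The number of dots `(i, i)` on the main diagonal of the Ferrers graph of `p`. The range loses
nothing: if `(i, i)` is a dot then `i < n`. -/
def diagLength {n : ℕ} (p : n.Partition) : ℕ :=
  ((Finset.range n).filter (fun i => i < rowLength p i)).card

/-- The Frobenius symbol of `p`, as the list of its columns `(x_i, y_i)`: `x_i` is the number of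
dots to the right of the `i`-th diagonal dot and `y_i` the number of dots below it. For
`i < diagLength p` both row `i` and column `i` have more than `i` dots, so that the subtractions
are not truncated. -/
def frobenius {n : ℕ} (p : n.Partition) : List (ℕ × ℕ) :=
  (List.range (diagLength p)).map
    (fun i => (rowLength p i - (i + 1), colLength p i - (i + 1)))

/-- A column `(x, y)` is positive if `x - y ≥ 1`. -/
abbrev IsPositive (c : ℕ × ℕ) : Prop := (c.1 : ℤ) - (c.2 : ℤ) ≥ 1

/-- A column `(x, y)` is negative if `x - y ≤ 0`. -/
abbrev IsNegative (c : ℕ × ℕ) : Prop := (c.1 : ℤ) - (c.2 : ℤ) ≤ 0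

/-- Two columns have the same parity if both are positive or both are negative. -/
abbrev SameParity (c c' : ℕ × ℕ) : Prop :=
  (IsPositive c ∧ IsPositive c') ∨ (IsNegative c ∧ IsNegative c')

/-- The parity blocks of `p`, from left to right: the maximal runs of contiguous columns of the
Frobenius symbol that have the same parity. -/
def parityBlocks {n : ℕ} (p : n.Partition) : List (List (ℕ × ℕ)) :=
  (frobenius p).splitBy (fun c c' => decide (SameParity c c'))

/-- The last parity block exists and consists of positive columns. -/
abbrev LastBlockPositive {n : ℕ} (p : n.Partition) : Prop :=
  ∃ B ∈ (parityBlocks p).getLast?, ∀ c ∈ B, IsPositive c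

/-- The last parity block exists and consists of negative columns. -/
abbrev LastBlockNegative {n : ℕ} (p : n.Partition) : Prop :=
  ∃ B ∈ (parityBlocks p).getLast?, ∀ c ∈ B, IsNegative c

/-- `a⁺_m(n; d)`: the number of partitions of `n` with exactly `d` columns and `m` parity blocks,
the last of which is positive. -/
def aPos (m d n : ℕ) : ℕ :=
  ((Finset.univ : Finset n.Partition).filter (fun p =>
    (frobenius p).length = d ∧ (parityBlocks p).length = m ∧ LastBlockPositive p)).card

/-- `a⁻_m(n; d)`: the number of partitions of `n` with exactly `d` columns and `m` parity blocks,
the last of which is negative. -/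
def aNeg (m d n : ℕ) : ℕ :=
  ((Finset.univ : Finset n.Partition).filter (fun p =>
    (frobenius p).length = d ∧ (parityBlocks p).length = m ∧ LastBlockNegative p)).card

/-- `(a; q)_n = (1 - a)(1 - a q) ⋯ (1 - a q ^ (n - 1))`. -/
def qPochhammer {R : Type*} [CommRing R] (a q : R) (n : ℕ) : R :=
  ∏ i ∈ Finset.range n, (1 - a * q ^ i)

/-- The `q`-binomial coefficient `(q; q)_n / ((q; q)_k (q; q)_{n - k})`, and `0` unless `k ≤ n`,
with `q = X` in the ring of formal power series. The inverse is a true one: the series inverted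
has constant term `1`. -/
noncomputable def qBinomial (n k : ℕ) : PowerSeries ℚ :=
  if k ≤ n then
    qPochhammer PowerSeries.X PowerSeries.X n *
      (qPochhammer PowerSeries.X PowerSeries.X k *
        qPochhammer PowerSeries.X PowerSeries.X (n - k))⁻¹
  else 0

end ParityBlocks

/-!
Cutting a Ferrers graph into its diagonal hooks identifies the partitions of `n` with `d` columns
with the pairs of strictly decreasing sequences of length `d` and total sum `n - d`; the parity
blocks become the runs in the sequence of column signs. Now allow the two sequences to have
different lengths, and count the arrays with more than `k` runs after a positive column has been
appended. Deleting the zero at the end of a row, if there is one, and lowering all entries by one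
gives recurrences for the generating functions. As long as the upper row stays longer, the number of
runs does not change; when the lower row becomes at least as long, exchanging the rows exchanges the
signs, at the cost of changing the sign given to a column with equal entries, so that both
conventions for this sign have to be treated together. The recurrences have an explicit solution,
and the difference of the solutions for consecutive `k` counts the arrays with exactly `m` runs.
-/

namespace ParityBlocks

open PowerSeries

/-! ### Runs and signs -/

/-- The number of runs (maximal constant contiguous segments) of a list of signs. -/
def runs : List Bool → ℕ
  | [] => 0
  | [_] => 1
  | a :: b :: l => (if a = b then 0 else 1) + runs (b :: l)

theorem runs_concat_pos (s : List Bool) (a : Bool) : 0 < runs (s ++ [a]) := by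
  fun_induction runs s <;> simp_all [runs]

theorem runs_concat_concat (s : List Bool) (a b : Bool) :
    runs (s ++ [a] ++ [b]) = runs (s ++ [a]) + if a = b then 0 else 1 := by
  fun_induction runs s <;> simp_all [runs, add_comm, add_left_comm]

theorem runs_map_not (s : List Bool) : runs (s.map (!·)) = runs s := by
  fun_induction runs s <;> simp_all [runs]

/-- The parities of the columns of the two-line array with rows `xs` and `ys`, where `true` stands
for positive. The tie parameter `e` is the sign given to a column with two equal entries, so that
`e = false` is the convention of the Frobenius symbol. Rows of different lengths are compared as if
the shorter one continued with entries smaller than every number. -/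
def signs (e : Bool) : List ℕ → List ℕ → List Bool
  | [], [] => []
  | _ :: xs, [] => true :: signs e xs []
  | [], _ :: ys => false :: signs e [] ys
  | x :: xs, y :: ys => decide (y < x + e.toNat) :: signs e xs ys

theorem signs_swap (e : Bool) (xs ys : List ℕ) :
    signs e ys xs = (signs (!e) xs ys).map (!·) := by
  fun_induction signs e ys xs with
  | case4 => cases e <;> simp_all [signs, ← decide_not]
  | _ => simp_all [signs]

theorem signs_map_succ (e : Bool) (xs ys : List ℕ) :
    signs e (xs.map Nat.succ) (ys.map Nat.succ) = signs e xs ys := by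
  fun_induction signs e xs ys <;> simp_all [signs, Nat.succ_eq_add_one, add_right_comm]

theorem signs_concat_left (e : Bool) {xs ys : List ℕ} (h : ys.length ≤ xs.length) (a : ℕ) :
    signs e (xs ++ [a]) ys = signs e xs ys ++ [true] := by
  fun_induction signs e xs ys <;> simp_all [signs]

theorem signs_concat_zero_right (e : Bool) {xs ys : List ℕ} (h : ys.length < xs.length) :
    signs e (xs.map Nat.succ) (ys ++ [0]) = signs e (xs.map Nat.succ) ys := by
  fun_induction signs e xs ys <;> simp_all [signs]

theorem signs_concat_concat (e : Bool) {xs ys : List ℕ} (h : xs.length = ys.length) (a : ℕ) :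
    signs e (xs ++ [a]) (ys ++ [a]) = signs e xs ys ++ [e] := by
  fun_induction signs e xs ys with
  | case1 => cases e <;> simp [signs]
  | _ => simp_all [signs]

theorem exists_signs_eq_concat_true (e : Bool) {xs ys : List ℕ} (h : ys.length < xs.length) :
    ∃ s, signs e xs ys = s ++ [true] := by
  obtain rfl | ⟨xs, a, rfl⟩ := xs.eq_nil_or_concat'
  · simp at h
  · exact ⟨_, signs_concat_left e (by simpa [Nat.lt_succ_iff] using h) a⟩

theorem signs_eq_map_zip (e : Bool) {xs ys : List ℕ} (h : xs.length = ys.length) :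
    signs e xs ys = (xs.zip ys).map fun c => decide (c.2 < c.1 + e.toNat) := by
  fun_induction signs e xs ys <;> simp_all [signs]

theorem runs_signs_concat (e : Bool) {xs ys : List ℕ} (h : ys.length < xs.length) :
    runs (signs e xs ys ++ [true]) = runs (signs e xs ys) := by
  obtain ⟨s, hs⟩ := exists_signs_eq_concat_true e h
  rw [hs, runs_concat_concat, if_pos rfl, add_zero]

theorem getLast?_signs (e : Bool) {xs ys : List ℕ} (h : ys.length < xs.length) :
    (signs e xs ys).getLast? = some true := by
  obtain ⟨s, hs⟩ := exists_signs_eq_concat_true e h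
  rw [hs, List.getLast?_concat]

/-- Raise all entries of a list by one and, if `z` is true, append a zero. A strictly decreasing
list is a lift in exactly one way, which is how the arrays are taken apart. -/
def lift (z : Bool) (xs : List ℕ) : List ℕ := xs.map Nat.succ ++ if z then [0] else []

theorem length_lift (z : Bool) (xs : List ℕ) : (lift z xs).length = xs.length + z.toNat := by
  cases z <;> simp [lift]

theorem sum_lift (z : Bool) (xs : List ℕ) : (lift z xs).sum = xs.sum + xs.length := by
  induction xs with
  | nil => cases z <;> rfl
  | cons x xs ih =>
    simp only [lift, List.map_cons, List.cons_append, List.sum_cons, List.length_cons] at ih ⊢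
    omega

theorem sortedGT_lift {z : Bool} {xs : List ℕ} : (lift z xs).SortedGT ↔ xs.SortedGT := by
  cases z <;> simp [lift, List.sortedGT_iff_pairwise, List.pairwise_append, List.pairwise_map]

theorem lift_injective : Function.Injective fun p : Bool × List ℕ => lift p.1 p.2 := by
  rintro ⟨z, xs⟩ ⟨z', xs'⟩ h
  have hz : z = z' := by
    have h0 (z xs) : 0 ∈ lift z xs ↔ z = true := by cases z <;> simp [lift]
    rw [Bool.eq_iff_iff, ← h0 z xs, ← h0 z' xs', show lift z xs = lift z' xs' from h]
  subst hz
  simpa [lift, List.map_inj_right] using h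

theorem exists_lift_eq {xs : List ℕ} (h : xs.SortedGT) : ∃ z xs', lift z xs' = xs := by
  induction xs with
  | nil => exact ⟨false, [], rfl⟩
  | cons x xs ih =>
    obtain ⟨hx, hxs⟩ := List.pairwise_cons.1 h.pairwise
    obtain ⟨z, xs', rfl⟩ := ih hxs.sortedGT
    cases x with
    | succ x => exact ⟨z, x :: xs', rfl⟩
    | zero =>
      have hnil : lift z xs' = [] :=
        List.eq_nil_iff_forall_not_mem.2 fun a ha => (hx a ha).not_ge a.zero_le
      exact ⟨true, [], by rw [hnil]; rfl⟩

theorem signs_lift_false_left (e : Bool) {w : Bool} {xs ys : List ℕ}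
    (h : ys.length + w.toNat ≤ xs.length) :
    signs e (lift false xs) (lift w ys) = signs e xs ys := by
  cases w with
  | false => simp [lift, signs_map_succ]
  | true =>
    have hys : (ys.map Nat.succ).length < xs.length := by simpa using h
    simpa [lift, signs_map_succ] using signs_concat_zero_right e hys

theorem signs_lift_true_left (e : Bool) {w : Bool} {xs ys : List ℕ}
    (h : ys.length + w.toNat ≤ xs.length) :
    signs e (lift true xs) (lift w ys) = signs e xs ys ++ [true] := by
  rw [← signs_lift_false_left e h, ← signs_concat_left e (by simpa [length_lift] using h) 0]
  simp [lift]

theorem signs_lift_true_true (e : Bool) {xs ys : List ℕ} (h : xs.length = ys.length) :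
    signs e (lift true xs) (lift true ys) = signs e xs ys ++ [e] := by
  simp [lift, signs_concat_concat, signs_map_succ, h]

theorem runs_signs_lift (e : Bool) {z w : Bool} {xs ys : List ℕ}
    (h : (lift w ys).length < (lift z xs).length) :
    runs (signs e (lift z xs) (lift w ys) ++ [true]) = runs (signs e xs ys ++ [true]) := by
  rw [length_lift, length_lift] at h
  cases z with
  | false => rw [signs_lift_false_left e h.le]
  | true =>
    rw [signs_lift_true_left e (Nat.lt_succ_iff.1 h), runs_concat_concat, if_pos rfl, add_zero]

/-! ### Generating functions of two-line arrays -/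

/-- The generating function `∑ X ^ w p` of the elements `p` of a set `A` by their weight. The
cardinalities are `Set.ncard`, so it is meaningful only if `A` has finitely many elements of each
weight. -/
noncomputable def genFun {α : Type*} (w : α → ℕ) (A : Set α) : ℚ⟦X⟧ :=
  .mk fun n => ({p ∈ A | w p = n}.ncard : ℚ)

section genFun

variable {α β ι : Type*} {v : α → ℕ} {w : β → ℕ} {A : Set α} {B : Set β}

theorem genFun_empty (v : α → ℕ) : genFun v ∅ = 0 := by
  ext n
  simp [genFun]

theorem genFun_singleton (v : α → ℕ) (a : α) : genFun v {a} = X ^ v a := by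
  ext n
  rw [coeff_X_pow, genFun, coeff_mk]
  split_ifs with h
  · rw [Set.ncard_eq_one.2 ⟨a, by ext; aesop⟩, Nat.cast_one]
  · rw [show {p ∈ ({a} : Set α) | v p = n} = ∅ by ext; aesop, Set.ncard_empty, Nat.cast_zero]

theorem genFun_of_bijOn {f : α → β} (hf : Set.BijOn f A B) {c : ℕ}
    (hv : ∀ a ∈ A, v a = w (f a) + c) : genFun v A = X ^ c * genFun w B := by
  ext n
  have hlevel : {b ∈ B | w b + c = n} = f '' {a ∈ A | v a = n} := by
    ext b
    rw [← hf.image_eq]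
    aesop
  have hncard : {a ∈ A | v a = n}.ncard = {b ∈ B | w b + c = n}.ncard := by
    rw [hlevel, (hf.injOn.mono fun a ha => ha.1).ncard_image]
  rw [coeff_X_pow_mul', genFun, coeff_mk, hncard]
  split_ifs with hc
  · simp only [genFun, coeff_mk, eq_tsub_iff_add_eq_of_le hc]
  · rw [show {b ∈ B | w b + c = n} = ∅ by ext; simp; omega, Set.ncard_empty, Nat.cast_zero]

theorem genFun_eq_sum [Fintype ι] {f : ι → α → β} (hB : ∀ n, {b ∈ B | w b = n}.Finite)
    (hf : Function.Injective fun p : ι × α => f p.1 p.2)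
    (hcover : ∀ b ∈ B, ∃ i a, f i a = b) :
    genFun w B = ∑ i, genFun (w ∘ f i) (f i ⁻¹' B) := by
  ext n
  have hlevel : {b ∈ B | w b = n} = ⋃ i, f i '' {a ∈ f i ⁻¹' B | (w ∘ f i) a = n} := by
    ext b
    simp only [Set.mem_iUnion, Set.mem_image]
    constructor
    · rintro ⟨hb, hn⟩
      obtain ⟨i, a, rfl⟩ := hcover b hb
      exact ⟨i, a, ⟨hb, hn⟩, rfl⟩
    · rintro ⟨i, a, ⟨hb, hn⟩, rfl⟩
      exact ⟨hb, hn⟩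
  have hinj (i) : (f i).Injective := fun a a' h => congr_arg Prod.snd (@hf (i, a) (i, a') h)
  simp only [map_sum, genFun, coeff_mk]
  rw [hlevel, Set.ncard_iUnion_of_finite, finsum_eq_sum_of_fintype, Nat.cast_sum]
  · simp only [Set.ncard_image_of_injective _ (hinj _)]
  · exact fun i => (hB n).subset (Set.image_subset_iff.2 fun _ ha => ha)
  · rintro i j hij
    refine Set.disjoint_left.2 ?_
    rintro _ ⟨a, -, rfl⟩ ⟨a', -, h⟩
    exact hij (congr_arg Prod.fst (@hf (j, a') (i, a) h)).symm

end genFun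

/-- The pairs of strictly decreasing lists of lengths `a` and `b` that satisfy `Q`: the two-line
arrays with rows of these lengths. -/
def pairs (a b : ℕ) (Q : List ℕ → List ℕ → Prop) : Set (List ℕ × List ℕ) :=
  {p | p.1.SortedGT ∧ p.2.SortedGT ∧ p.1.length = a ∧ p.2.length = b ∧ Q p.1 p.2}

/-- The sum of all entries of a two-line array. -/
def totalSum (p : List ℕ × List ℕ) : ℕ := p.1.sum + p.2.sum

/-- The generating function, by the sum of the entries, of the two-line arrays with rows of
lengths `a` and `b` that satisfy `Q`. -/
noncomputable def genPairs (a b : ℕ) (Q : List ℕ → List ℕ → Prop) : ℚ⟦X⟧ :=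
  genFun totalSum (pairs a b Q)

theorem finite_sortedGT_sum_le (n : ℕ) : {l : List ℕ | l.SortedGT ∧ l.sum ≤ n}.Finite := by
  refine Set.Finite.of_finite_image (f := List.toFinset)
    ((Finset.Iic n).powerset.finite_toSet.subset ?_) ?_
  · rintro _ ⟨l, ⟨-, hl⟩, rfl⟩
    simpa [Set.subset_def] using fun x hx => (List.le_sum_of_mem hx).trans hl
  · intro l hl l' hl' h
    refine hl.1.eq_of_mem_iff hl'.1 fun x => ?_
    rw [← List.mem_toFinset, h, List.mem_toFinset]

section genPairs

variable {a b : ℕ} {Q Q' : List ℕ → List ℕ → Prop}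

theorem finite_pairs_totalSum (a b : ℕ) (Q : List ℕ → List ℕ → Prop) (n : ℕ) :
    {p ∈ pairs a b Q | totalSum p = n}.Finite := by
  refine ((finite_sortedGT_sum_le n).prod (finite_sortedGT_sum_le n)).subset ?_
  rintro p ⟨⟨hx, hy, -⟩, hn⟩
  exact ⟨⟨hx, hn ▸ Nat.le_add_right _ _⟩, ⟨hy, hn ▸ Nat.le_add_left _ _⟩⟩

theorem genPairs_congr
    (h : ∀ xs ys : List ℕ, xs.length = a → ys.length = b → (Q xs ys ↔ Q' xs ys)) :
    genPairs a b Q = genPairs a b Q' := by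
  have hpairs : pairs a b Q = pairs a b Q' := by
    ext p
    simp only [pairs, Set.mem_ofPred_eq]
    grind
  rw [genPairs, genPairs, hpairs]

theorem genPairs_eq_zero (h : ∀ xs ys : List ℕ, xs.length = a → ys.length = b → ¬ Q xs ys) :
    genPairs a b Q = 0 := by
  have hpairs : pairs a b Q = ∅ := by
    ext p
    simp only [pairs, Set.mem_ofPred_eq, Set.mem_empty_iff_false]
    grind
  rw [genPairs, hpairs, genFun_empty]

theorem genPairs_zero_zero (h : Q [] []) : genPairs 0 0 Q = 1 := by
  have hpairs : pairs 0 0 Q = {([], [])} := by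
    ext ⟨xs, ys⟩
    simp only [pairs, List.length_eq_zero_iff, Set.mem_ofPred_eq, Set.mem_singleton_iff,
      Prod.mk.injEq]
    constructor
    · exact fun ⟨_, _, hx, hy, _⟩ => ⟨hx, hy⟩
    · rintro ⟨rfl, rfl⟩
      simpa [List.sortedGT_iff_pairwise] using h
  rw [genPairs, hpairs, genFun_singleton]
  rfl

theorem genPairs_swap (a b : ℕ) (Q : List ℕ → List ℕ → Prop) :
    genPairs a b Q = genPairs b a fun xs ys => Q ys xs := by
  have hswap : Set.BijOn Prod.swap (pairs a b Q) (pairs b a fun xs ys => Q ys xs) := by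
    refine ⟨fun p hp => ?_, Prod.swap_injective.injOn, fun p hp => ⟨p.swap, ?_, p.swap_swap⟩⟩ <;>
    · simp only [pairs, Set.mem_ofPred_eq, Prod.fst_swap, Prod.snd_swap] at hp ⊢
      tauto
  simpa [genPairs] using genFun_of_bijOn hswap (v := totalSum) (w := totalSum) (c := 0) fun p _ =>
    Nat.add_comm _ _

theorem genPairs_eq_sum (a b : ℕ) (Q : List ℕ → List ℕ → Prop) :
    genPairs a b Q = ∑ z : Bool × Bool,
      genFun (totalSum ∘ Prod.map (lift z.1) (lift z.2))
        (Prod.map (lift z.1) (lift z.2) ⁻¹' pairs a b Q) := by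
  refine genFun_eq_sum (finite_pairs_totalSum a b Q) ?_ ?_
  · rintro ⟨⟨z, w⟩, xs, ys⟩ ⟨⟨z', w'⟩, xs', ys'⟩ h
    obtain ⟨hx, hy⟩ := Prod.mk.inj h
    obtain ⟨rfl, rfl⟩ := Prod.mk.inj (@lift_injective (z, xs) (z', xs') hx)
    obtain ⟨rfl, rfl⟩ := Prod.mk.inj (@lift_injective (w, ys) (w', ys') hy)
    rfl
  · rintro ⟨xs, ys⟩ ⟨hx, hy, -⟩
    obtain ⟨z, xs, rfl⟩ := exists_lift_eq hx
    obtain ⟨w, ys, rfl⟩ := exists_lift_eq hy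
    exact ⟨(z, w), (xs, ys), rfl⟩

theorem genFun_preimage_lift (z w : Bool) (a b : ℕ) (Q : List ℕ → List ℕ → Prop) :
    genFun (totalSum ∘ Prod.map (lift z) (lift w))
        (Prod.map (lift z) (lift w) ⁻¹' pairs (a + z.toNat) (b + w.toNat) Q) =
      X ^ (a + b) * genPairs a b fun xs ys => Q (lift z xs) (lift w ys) := by
  have hpreimage : Prod.map (lift z) (lift w) ⁻¹' pairs (a + z.toNat) (b + w.toNat) Q =
      pairs a b fun xs ys => Q (lift z xs) (lift w ys) := by
    ext p
    simp [pairs, sortedGT_lift, length_lift]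
  rw [hpreimage]
  refine genFun_of_bijOn (Set.bijOn_id _) fun p hp => ?_
  obtain ⟨-, -, hx, hy, -⟩ := hp
  simp only [totalSum, Function.comp_apply, id, Prod.map_fst, Prod.map_snd, sum_lift, hx, hy]
  omega

theorem genPairs_succ_succ (a b : ℕ) (Q : List ℕ → List ℕ → Prop) :
    genPairs (a + 1) (b + 1) Q =
      X ^ (a + b + 2) *
          genPairs (a + 1) (b + 1) (fun xs ys => Q (lift false xs) (lift false ys)) +
        X ^ (a + b + 1) *
          (genPairs a (b + 1) (fun xs ys => Q (lift true xs) (lift false ys)) +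
            genPairs (a + 1) b fun xs ys => Q (lift false xs) (lift true ys)) +
        X ^ (a + b) * genPairs a b fun xs ys => Q (lift true xs) (lift true ys) := by
  have hff := genFun_preimage_lift false false (a + 1) (b + 1) Q
  have htf := genFun_preimage_lift true false a (b + 1) Q
  have hft := genFun_preimage_lift false true (a + 1) b Q
  have htt := genFun_preimage_lift true true a b Q
  simp only [Bool.toNat_false, Bool.toNat_true, add_zero] at hff htf hft htt
  rw [genPairs_eq_sum, Fintype.sum_prod_type]
  simp only [Fintype.sum_bool, hff, htf, hft, htt]
  ring

theorem genPairs_succ_zero (a : ℕ) (Q : List ℕ → List ℕ → Prop) :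
    genPairs (a + 1) 0 Q =
      X ^ (a + 1) * genPairs (a + 1) 0 (fun xs ys => Q (lift false xs) (lift false ys)) +
        X ^ a * genPairs a 0 fun xs ys => Q (lift true xs) (lift false ys) := by
  have hf := genFun_preimage_lift false false (a + 1) 0 Q
  have ht := genFun_preimage_lift true false a 0 Q
  have hempty (z : Bool) :
      Prod.map (lift z) (lift true) ⁻¹' pairs (a + 1) 0 Q = ∅ := by
    ext p
    simp [pairs, lift]
  simp only [Bool.toNat_false, Bool.toNat_true, add_zero] at hf ht
  rw [genPairs_eq_sum, Fintype.sum_prod_type]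
  simp only [Fintype.sum_bool, hf, ht, hempty, genFun_empty]
  ring

end genPairs

/-- The two-line array with rows `xs` and `ys` has more than `k` parity blocks once a positive
column has been appended. If `ys` is shorter than `xs`, the appended column changes nothing. -/
def ManyRuns (e : Bool) (k : ℕ) (xs ys : List ℕ) : Prop := k < runs (signs e xs ys ++ [true])

section ManyRuns

variable {e : Bool} {k : ℕ} {xs ys : List ℕ}

theorem manyRuns_zero (e : Bool) (xs ys : List ℕ) : ManyRuns e 0 xs ys := runs_concat_pos _ _

theorem manyRuns_lift {z w : Bool} (h : (lift w ys).length < (lift z xs).length) :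
    ManyRuns e k (lift z xs) (lift w ys) ↔ ManyRuns e k xs ys := by
  rw [ManyRuns, runs_signs_lift e h, ManyRuns]

theorem manyRuns_lift_false_left {w : Bool} (h : ys.length + w.toNat ≤ xs.length) :
    ManyRuns e k (lift false xs) (lift w ys) ↔ ManyRuns e k xs ys := by
  rw [ManyRuns, signs_lift_false_left e h, ManyRuns]

theorem manyRuns_lift_true_false (h : xs.length < ys.length) :
    ManyRuns e k (lift true xs) (lift false ys) ↔ ManyRuns (!e) (k - 1) ys xs := by
  obtain ⟨s, hs⟩ := exists_signs_eq_concat_true (!e) h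
  have hpos := runs_concat_pos s true
  have hruns : runs (signs e (lift true xs) (lift false ys) ++ [true]) =
      runs (s ++ [true]) + 1 := by
    rw [signs_swap, signs_lift_false_left _ (by simpa using h), hs, ← runs_map_not (s ++ [true])]
    simp [runs_concat_concat, -List.append_assoc]
  rw [ManyRuns, ManyRuns, hruns, runs_signs_concat _ h, hs]
  omega

theorem manyRuns_true_lift_true_true (h : xs.length = ys.length) :
    ManyRuns true k (lift true xs) (lift true ys) ↔ ManyRuns true k xs ys := by
  rw [ManyRuns, signs_lift_true_true true h, runs_concat_concat, if_pos rfl, add_zero, ManyRuns]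

theorem manyRuns_false_lift_true_true (h : xs.length = ys.length) :
    ManyRuns false k (lift true xs) (lift true ys) ↔ ManyRuns true (k - 1) ys xs := by
  have hpos := runs_concat_pos (signs true ys xs) true
  have hruns : runs (signs false xs ys ++ [false]) = runs (signs true ys xs ++ [true]) := by
    rw [signs_swap, ← runs_map_not (_ ++ [true])]
    simp
  rw [ManyRuns, signs_lift_true_true false h, runs_concat_concat, hruns, ManyRuns,
    if_neg Bool.false_ne_true]
  omega

end ManyRuns

theorem genPairs_zero_zero_manyRuns (e : Bool) (k : ℕ) :
    genPairs 0 0 (ManyRuns e k) = if k = 0 then 1 else 0 := by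
  split_ifs with hk
  · exact genPairs_zero_zero (hk ▸ manyRuns_zero e [] [])
  · refine genPairs_eq_zero fun xs ys hx hy => ?_
    rw [List.length_eq_zero_iff.1 hx, List.length_eq_zero_iff.1 hy]
    simpa [ManyRuns, signs, runs, Nat.pos_iff_ne_zero] using hk

theorem genPairs_succ_zero_manyRuns (e : Bool) (k a : ℕ) :
    (1 - X ^ (a + 1)) * genPairs (a + 1) 0 (ManyRuns e k) =
      X ^ a * genPairs a 0 (ManyRuns e k) := by
  have hlift (z : Bool) (a' : ℕ) (h : 0 < a' + z.toNat) :
      genPairs a' 0 (fun xs ys => ManyRuns e k (lift z xs) (lift false ys)) =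
        genPairs a' 0 (ManyRuns e k) :=
    genPairs_congr fun xs ys hx hy => manyRuns_lift (by simpa [length_lift, hx, hy] using h)
  have hrec := genPairs_succ_zero a (ManyRuns e k)
  rw [hlift false (a + 1) (by simp), hlift true a (by simp)] at hrec
  linear_combination hrec

theorem genPairs_succ_succ_manyRuns (e : Bool) (k : ℕ) {a b : ℕ} (h : b < a) :
    (1 - X ^ (a + b + 2)) * genPairs (a + 1) (b + 1) (ManyRuns e k) =
      X ^ (a + b + 1) *
          (genPairs a (b + 1) (ManyRuns e k) + genPairs (a + 1) b (ManyRuns e k)) +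
        X ^ (a + b) * genPairs a b (ManyRuns e k) := by
  have hlift (z w : Bool) (a' b' : ℕ) (h : b' + w.toNat < a' + z.toNat) :
      genPairs a' b' (fun xs ys => ManyRuns e k (lift z xs) (lift w ys)) =
        genPairs a' b' (ManyRuns e k) :=
    genPairs_congr fun xs ys hx hy => manyRuns_lift (by simpa [length_lift, hx, hy] using h)
  have hrec := genPairs_succ_succ a b (ManyRuns e k)
  rw [hlift false false _ _ (by simpa using h), hlift true false _ _ (by simpa using h),
    hlift false true _ _ (by simpa using h), hlift true true _ _ (by simpa using h)] at hrec
  linear_combination hrec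

theorem genPairs_diag_manyRuns (e : Bool) (k a : ℕ) :
    (1 - X ^ (2 * a + 2)) * genPairs (a + 1) (a + 1) (ManyRuns e k) =
      X ^ (2 * a + 1) * (genPairs (a + 1) a (ManyRuns (!e) (k - 1)) +
        genPairs (a + 1) a (ManyRuns e k)) +
      X ^ (2 * a) * genPairs a a (ManyRuns true (if e then k else k - 1)) := by
  have hff : genPairs (a + 1) (a + 1)
      (fun xs ys => ManyRuns e k (lift false xs) (lift false ys)) =
        genPairs (a + 1) (a + 1) (ManyRuns e k) :=
    genPairs_congr fun xs ys hx hy => manyRuns_lift_false_left (by simp [hx, hy])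
  have hft : genPairs (a + 1) a (fun xs ys => ManyRuns e k (lift false xs) (lift true ys)) =
      genPairs (a + 1) a (ManyRuns e k) :=
    genPairs_congr fun xs ys hx hy => manyRuns_lift_false_left (by simp [hx, hy])
  have htf : genPairs a (a + 1) (fun xs ys => ManyRuns e k (lift true xs) (lift false ys)) =
      genPairs (a + 1) a (ManyRuns (!e) (k - 1)) := by
    rw [genPairs_swap]
    exact genPairs_congr fun xs ys hx hy => manyRuns_lift_true_false (by simp [hx, hy])
  have htt : genPairs a a (fun xs ys => ManyRuns e k (lift true xs) (lift true ys)) =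
      genPairs a a (ManyRuns true (if e then k else k - 1)) := by
    cases e with
    | true =>
      exact genPairs_congr fun xs ys hx hy => manyRuns_true_lift_true_true (hx.trans hy.symm)
    | false =>
      rw [genPairs_swap]
      exact genPairs_congr fun xs ys hx hy => manyRuns_false_lift_true_true (hy.trans hx.symm)
  have hrec := genPairs_succ_succ a a (ManyRuns e k)
  rw [hff, hft, htf, htt] at hrec
  linear_combination hrec

/-! ### The closed form -/

theorem one_sub_X_pow_ne_zero {n : ℕ} (hn : n ≠ 0) : (1 - X ^ n : ℚ⟦X⟧) ≠ 0 := by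
  intro h
  simpa [hn] using congr_arg constantCoeff h

/-- `1 / (q; q)_n` with `q = X`. -/
noncomputable def invPoch (n : ℕ) : ℚ⟦X⟧ := (qPochhammer X X n)⁻¹

theorem constantCoeff_qPochhammer (n : ℕ) :
    constantCoeff (qPochhammer X X n : ℚ⟦X⟧) = 1 := by
  simp [qPochhammer, map_prod]

theorem invPoch_zero : invPoch 0 = 1 := by simp [invPoch, qPochhammer]

theorem one_sub_mul_invPoch_succ (n : ℕ) :
    (1 - X ^ (n + 1)) * invPoch (n + 1) = invPoch n := by
  have hn : constantCoeff (qPochhammer X X n : ℚ⟦X⟧) ≠ 0 := by simp [constantCoeff_qPochhammer]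
  have hn' : constantCoeff (qPochhammer X X (n + 1) : ℚ⟦X⟧) ≠ 0 := by
    simp [constantCoeff_qPochhammer]
  have hsucc : qPochhammer X X (n + 1) = qPochhammer X X n * (1 - X ^ (n + 1) : ℚ⟦X⟧) := by
    simp [qPochhammer, Finset.prod_range_succ, pow_succ']
  rw [invPoch, invPoch, PowerSeries.eq_inv_iff_mul_eq_one hn, mul_comm, ← mul_assoc, ← hsucc,
    PowerSeries.mul_inv_cancel _ hn']

/-- `1 / (q; q)_(n - k)` with `q = X`, taken to be `0` if `n < k`. -/
noncomputable def invPochSub (n k : ℕ) : ℚ⟦X⟧ := if k ≤ n then invPoch (n - k) else 0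

-- Multiplied through by `X ^ k`: the exponent of the factor `1 - X ^ (n + 1 - k)` may be truncated.
theorem invPochSub_eq (n k : ℕ) :
    X ^ k * invPochSub n k = (X ^ k - X ^ (n + 1)) * invPochSub (n + 1) k := by
  obtain h | rfl | h := lt_trichotomy k (n + 1)
  · obtain ⟨v, rfl⟩ := Nat.exists_eq_add_of_le (Nat.lt_succ_iff.1 h)
    have hsucc := one_sub_mul_invPoch_succ v
    simp only [invPochSub, Nat.le_add_right, if_true, add_assoc,
      Nat.add_sub_cancel_left]
    rw [← hsucc]
    ring
  · simp [invPochSub]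
  · simp [invPochSub, h.not_ge, (n.lt_succ_self.trans h).not_ge]

theorem invPochSub_succ_succ (n k : ℕ) : invPochSub (n + 1) (k + 1) = invPochSub n k := by
  simp [invPochSub]

/-- The generating function of the two-line arrays with rows of lengths `b + t` and `b` that satisfy
`ManyRuns e k`, see `genPairs_manyRuns`. As in a reflection principle, up to a power of `X` it is
that of all arrays with rows of lengths `b + t + k` and `b - k`. -/
noncomputable def closedForm (e : Bool) (k t b : ℕ) : ℚ⟦X⟧ :=
  X ^ ((b + t).choose 2 + b.choose 2 + t * k + k.choose 2 + e.toNat * k) *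
    invPoch (b + t + k) * invPochSub b k

theorem succ_choose_two (n : ℕ) : (n + 1).choose 2 = n + n.choose 2 := by
  rw [Nat.choose_succ_succ', Nat.choose_one_right]

theorem closedForm_succ_zero (e : Bool) (k t : ℕ) :
    (1 - X ^ (t + 1)) * closedForm e k (t + 1) 0 = X ^ t * closedForm e k t 0 := by
  cases k with
  | zero =>
    have hsucc := one_sub_mul_invPoch_succ t
    simp only [closedForm, zero_add, add_zero, mul_zero, succ_choose_two,
      Nat.choose_zero_succ, ← hsucc]
    ring
  | succ k => simp [closedForm, invPochSub]

theorem closedForm_succ_succ (e : Bool) (k t b : ℕ) :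
    (1 - X ^ (2 * b + t + 3)) * closedForm e k (t + 1) (b + 1) =
      X ^ (2 * b + t + 2) * (closedForm e k t (b + 1) + closedForm e k (t + 2) b) +
        X ^ (2 * b + t + 1) * closedForm e k (t + 1) b := by
  have hI := one_sub_mul_invPoch_succ (b + 1 + t + k)
  have hR := invPochSub_eq b k
  simp only [closedForm, show b + 1 + (t + 1) = b + 1 + t + 1 by ring,
    show b + (t + 2) = b + 1 + t + 1 by ring, show b + (t + 1) = b + 1 + t by ring,
    succ_choose_two, add_right_comm _ 1 k, ← hI]
  linear_combination -(X ^ (2 * b + t + 1 + (b + 1 + t).choose 2 + b.choose 2 + t * k +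
    k.choose 2 + e.toNat * k) * invPoch (b + 1 + t + k + 1)) * hR

theorem closedForm_diag (e : Bool) (k b : ℕ) :
    (1 - X ^ (2 * b + 2)) * closedForm e k 0 (b + 1) =
      X ^ (2 * b + 1) * (closedForm (!e) (k - 1) 1 b + closedForm e k 1 b) +
        X ^ (2 * b) * closedForm true (if e then k else k - 1) 0 b := by
  cases k with
  | zero =>
    have hI := one_sub_mul_invPoch_succ b
    have hR := invPochSub_eq b 0
    simp only [closedForm, succ_choose_two, ← hI, Nat.zero_sub, ite_self, Nat.choose_zero_succ,
      add_zero, mul_zero]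
    linear_combination -(X ^ (2 * b + 2 * b.choose 2) * invPoch (b + 1) * (1 + X ^ (b + 1))) * hR
  | succ k =>
    have hI := one_sub_mul_invPoch_succ (b + k)
    have hI' := one_sub_mul_invPoch_succ (b + k + 1)
    have hR := invPochSub_eq b (k + 1)
    rw [invPochSub_succ_succ] at hR
    cases e with
    | false =>
      simp only [closedForm, succ_choose_two, add_zero, Nat.add_sub_cancel, Bool.not_false,
        Bool.toNat_false, Bool.toNat_true, Bool.false_eq_true, if_false, invPochSub_succ_succ,
        show b + 1 + k = b + k + 1 by ring, show b + 1 + (k + 1) = b + k + 1 + 1 by ring,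
        ← hI, ← hI']
      linear_combination -(X ^ (3 * b + 2 * b.choose 2 + k + k.choose 2 + 1) *
        invPoch (b + k + 1 + 1)) * hR
    | true =>
      simp only [closedForm, succ_choose_two, add_zero, Nat.add_sub_cancel, Bool.not_true,
        Bool.toNat_false, Bool.toNat_true, if_true, invPochSub_succ_succ,
        show b + 1 + k = b + k + 1 by ring, show b + (k + 1) = b + k + 1 by ring,
        show b + 1 + (k + 1) = b + k + 1 + 1 by ring, ← hI']
      linear_combination -(X ^ (2 * b + 2 * b.choose 2 + k + k.choose 2) *
        invPoch (b + k + 1 + 1)) * hR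

theorem genPairs_manyRuns (e : Bool) (k t b : ℕ) :
    genPairs (b + t) b (ManyRuns e k) = closedForm e k t b := by
  induction b generalizing e k t with
  | zero =>
    induction t with
    | zero =>
      rw [genPairs_zero_zero_manyRuns]
      cases k <;> simp [closedForm, invPochSub, invPoch_zero]
    | succ t ih =>
      refine mul_left_cancel₀ (one_sub_X_pow_ne_zero t.succ_ne_zero) ?_
      rw [closedForm_succ_zero, ← ih]
      simpa using genPairs_succ_zero_manyRuns e k t
  | succ b ihb =>
    induction t with
    | zero =>
      refine mul_left_cancel₀ (one_sub_X_pow_ne_zero (2 * b + 1).succ_ne_zero) ?_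
      rw [closedForm_diag, ← ihb, ← ihb, ← ihb]
      exact genPairs_diag_manyRuns e k b
    | succ t iht =>
      have hrec := genPairs_succ_succ_manyRuns e k (show b < b + 1 + t by omega)
      refine mul_left_cancel₀ (one_sub_X_pow_ne_zero (2 * b + t + 2).succ_ne_zero) ?_
      rw [closedForm_succ_succ, ← iht, ← ihb, ← ihb, show b + (t + 1) = b + 1 + t by ring,
        show b + (t + 2) = b + 1 + t + 1 by ring]
      rw [show b + 1 + t + b = 2 * b + t + 1 by ring] at hrec
      exact hrec

/-- The last column of the array is positive, and it has more than `k` parity blocks. -/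
def ManyRunsEndingTrue (e : Bool) (k : ℕ) (xs ys : List ℕ) : Prop :=
  k < runs (signs e xs ys) ∧ (signs e xs ys).getLast? = some true

section ManyRunsEndingTrue

variable {e : Bool} {k : ℕ} {xs ys : List ℕ}

theorem manyRunsEndingTrue_lift_false_false (h : xs.length = ys.length) :
    ManyRunsEndingTrue e k (lift false xs) (lift false ys) ↔ ManyRunsEndingTrue e k xs ys := by
  rw [ManyRunsEndingTrue, signs_lift_false_left e (by simp [h]), ManyRunsEndingTrue]

theorem manyRunsEndingTrue_lift_false_true (h : ys.length < xs.length) :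
    ManyRunsEndingTrue e k (lift false xs) (lift true ys) ↔ ManyRuns e k xs ys := by
  rw [ManyRunsEndingTrue, signs_lift_false_left (w := true) e h, ManyRuns, runs_signs_concat e h]
  exact and_iff_left (getLast?_signs e h)

theorem not_manyRunsEndingTrue_lift_true_false (h : xs.length < ys.length) :
    ¬ ManyRunsEndingTrue e k (lift true xs) (lift false ys) := by
  have hlast : (signs e (lift true xs) (lift false ys)).getLast? = some false := by
    rw [signs_swap, signs_lift_false_left (w := true) _ h, List.getLast?_map, getLast?_signs _ h]
    rfl
  simp [ManyRunsEndingTrue, hlast]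

theorem manyRunsEndingTrue_lift_true_true (h : xs.length = ys.length) :
    ManyRunsEndingTrue e k (lift true xs) (lift true ys) ↔ ManyRuns e k xs ys ∧ e = true := by
  rw [ManyRunsEndingTrue, signs_lift_true_true e h, List.getLast?_concat, Option.some_inj, ManyRuns]
  exact and_congr_left fun he => by rw [he]

end ManyRunsEndingTrue

theorem genPairs_diag_manyRunsEndingTrue (e : Bool) (k a : ℕ) :
    (1 - X ^ (2 * a + 2)) * genPairs (a + 1) (a + 1) (ManyRunsEndingTrue e k) =
      X ^ (2 * a + 1) * genPairs (a + 1) a (ManyRuns e k) +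
        X ^ (2 * a) * if e then genPairs a a (ManyRuns true k) else 0 := by
  have hff : genPairs (a + 1) (a + 1)
      (fun xs ys => ManyRunsEndingTrue e k (lift false xs) (lift false ys)) =
        genPairs (a + 1) (a + 1) (ManyRunsEndingTrue e k) :=
    genPairs_congr fun xs ys hx hy => manyRunsEndingTrue_lift_false_false (hx.trans hy.symm)
  have hft : genPairs (a + 1) a
      (fun xs ys => ManyRunsEndingTrue e k (lift false xs) (lift true ys)) =
        genPairs (a + 1) a (ManyRuns e k) :=
    genPairs_congr fun xs ys hx hy => manyRunsEndingTrue_lift_false_true (by omega)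
  have htf : genPairs a (a + 1)
      (fun xs ys => ManyRunsEndingTrue e k (lift true xs) (lift false ys)) = 0 :=
    genPairs_eq_zero fun xs ys hx hy => not_manyRunsEndingTrue_lift_true_false (by omega)
  have htt : genPairs a a (fun xs ys => ManyRunsEndingTrue e k (lift true xs) (lift true ys)) =
      if e then genPairs a a (ManyRuns true k) else 0 := by
    have hiff (xs ys : List ℕ) (hx : xs.length = a) (hy : ys.length = a) :=
      manyRunsEndingTrue_lift_true_true (e := e) (k := k) (hx.trans hy.symm)
    cases e with
    | true => exact genPairs_congr fun xs ys hx hy => by rw [hiff xs ys hx hy, and_iff_left rfl]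
    | false => exact genPairs_eq_zero fun xs ys hx hy => by simp [hiff xs ys hx hy]
  have hrec := genPairs_succ_succ a a (ManyRunsEndingTrue e k)
  rw [hff, hft, htf, htt] at hrec
  linear_combination hrec

theorem one_sub_mul_genPairs_manyRunsEndingTrue (e : Bool) (k a : ℕ) :
    (1 - X ^ (2 * a + 2)) * genPairs (a + 1) (a + 1) (ManyRunsEndingTrue e k) =
      X ^ (2 * (a + 1).choose 2 + (!e).toNat * (a + 1) + (k + 1).choose 2) *
        invPoch (a + 1 + k) * invPochSub a k := by
  have hI := one_sub_mul_invPoch_succ (a + k)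
  have hdiag := genPairs_manyRuns true k 0 a
  rw [add_zero] at hdiag
  rw [genPairs_diag_manyRunsEndingTrue, genPairs_manyRuns e k 1 a, hdiag]
  cases e <;>
  · simp only [closedForm, succ_choose_two, Bool.not_false, Bool.not_true, Bool.toNat_false,
      Bool.toNat_true, if_true, Bool.false_eq_true, if_false, add_zero, add_right_comm a 1 k, ← hI]
    ring

theorem genPairs_and_add_and_not (a b : ℕ) (Q R : List ℕ → List ℕ → Prop) :
    genPairs a b (fun xs ys => Q xs ys ∧ R xs ys) +
      genPairs a b (fun xs ys => Q xs ys ∧ ¬ R xs ys) = genPairs a b Q := by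
  ext n
  simp only [genPairs, genFun, map_add, coeff_mk]
  rw [← Set.ncard_inter_add_ncard_sdiff_eq_ncard {p ∈ pairs a b Q | totalSum p = n}
    {p | R p.1 p.2} (finite_pairs_totalSum a b Q n), Nat.cast_add]
  congr 3 <;>
  · ext p
    simp only [pairs, Set.mem_ofPred_eq, Set.mem_inter_iff, Set.mem_sdiff]
    tauto

/-- The array has `m` parity blocks and its last column is positive. -/
def RunsEndingTrue (e : Bool) (m : ℕ) (xs ys : List ℕ) : Prop :=
  runs (signs e xs ys) = m ∧ (signs e xs ys).getLast? = some true

theorem one_sub_mul_genPairs_runsEndingTrue (e : Bool) {d m : ℕ} (hd : d ≠ 0) (hm : m ≠ 0) :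
    (1 - X ^ d) * genPairs d d (RunsEndingTrue e m) =
      X ^ (2 * d.choose 2 + (!e).toNat * d + m.choose 2) * (1 - X ^ m) *
        (invPoch (d + m) * invPochSub d m) := by
  obtain ⟨a, rfl⟩ := Nat.exists_eq_add_one_of_ne_zero hd
  obtain ⟨k, rfl⟩ := Nat.exists_eq_add_one_of_ne_zero hm
  have hsplit : genPairs (a + 1) (a + 1) (ManyRunsEndingTrue e (k + 1)) +
      genPairs (a + 1) (a + 1) (RunsEndingTrue e (k + 1)) =
        genPairs (a + 1) (a + 1) (ManyRunsEndingTrue e k) := by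
    rw [← genPairs_and_add_and_not _ _ (ManyRunsEndingTrue e k) (ManyRunsEndingTrue e (k + 1))]
    congr 1 <;>
    · refine genPairs_congr fun xs ys _ _ => ?_
      simp only [ManyRunsEndingTrue, RunsEndingTrue]
      grind
  have hk := one_sub_mul_genPairs_manyRunsEndingTrue e k a
  have hk' := one_sub_mul_genPairs_manyRunsEndingTrue e (k + 1) a
  have hI := one_sub_mul_invPoch_succ (a + 1 + k)
  have hR := invPochSub_eq a (k + 1)
  rw [← invPochSub_succ_succ a k, ← hI] at hk
  rw [succ_choose_two (k + 1)] at hk'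
  refine mul_left_cancel₀ (a := 1 + X ^ (a + 1)) (fun h => ?_) ?_
  · simpa using congr_arg constantCoeff h
  · linear_combination (1 - X ^ (2 * a + 2)) * hsplit + hk - hk' -
      X ^ (2 * (a + 1).choose 2 + (!e).toNat * (a + 1) + (k + 1).choose 2) *
        invPoch (a + 1 + k + 1) * hR

theorem inv_qPochhammer_mul_qBinomial (n k : ℕ) :
    (qPochhammer X X n)⁻¹ * qBinomial n k = invPoch k * invPochSub n k := by
  have hn : constantCoeff (qPochhammer X X n : ℚ⟦X⟧) ≠ 0 := by simp [constantCoeff_qPochhammer]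
  rw [qBinomial, invPochSub]
  split_ifs with h
  · rw [← mul_assoc, PowerSeries.inv_mul_cancel _ hn, one_mul, PowerSeries.mul_inv_rev, mul_comm]
    rfl
  · rw [mul_zero, mul_zero]

theorem sq_eq_add_two_mul_choose_two (n : ℕ) : n ^ 2 = n + 2 * n.choose 2 := by
  induction n with
  | zero => rfl
  | succ n ih =>
    rw [succ_choose_two]
    linear_combination ih

theorem X_pow_mul_genPairs_runsEndingTrue (e : Bool) {d m : ℕ} (hd : d ≠ 0) (hm : m ≠ 0) :
    X ^ d * genPairs d d (RunsEndingTrue e m) =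
      X ^ (d ^ 2 + (!e).toNat * d + m.choose 2) * (qPochhammer X X (2 * d))⁻¹ *
        ((1 - X ^ m) * (1 - X ^ d)⁻¹) * qBinomial (2 * d) (d + m) := by
  have hinv : (1 - X ^ d : ℚ⟦X⟧) * (1 - X ^ d)⁻¹ = 1 :=
    PowerSeries.mul_inv_cancel _ (by simp [hd])
  have hbinom := inv_qPochhammer_mul_qBinomial (2 * d) (d + m)
  have hsub : invPochSub (2 * d) (d + m) = invPochSub d m := by
    simp only [invPochSub, two_mul, Nat.add_le_add_iff_left, Nat.add_sub_add_left]
  have hgen := one_sub_mul_genPairs_runsEndingTrue e hd hm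
  rw [← hsub, ← hbinom] at hgen
  rw [sq_eq_add_two_mul_choose_two]
  linear_combination (1 - X ^ d)⁻¹ * X ^ d * hgen -
    X ^ d * genPairs d d (RunsEndingTrue e m) * hinv

/-! ### Parity blocks as runs of signs -/

section splitBy

variable {α : Type*} {r : α → α → Bool} {f : α → Bool}

theorem length_splitBy_loop (hr : ∀ a b, r a b = decide (f a = f b)) (l : List α) (a : α)
    (g : List α) (gs : List (List α)) :
    (List.splitBy.loop r l a g gs).length = gs.length + runs ((a :: l).map f) := by
  induction l generalizing a g gs with
  | nil => simp [List.splitBy.loop, runs]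
  | cons b l ih =>
    by_cases h : f a = f b
    · simp [List.splitBy.loop, hr, h, ih, runs]
    · simp [List.splitBy.loop, hr, h, ih, runs, add_assoc]

theorem length_splitBy (hr : ∀ a b, r a b = decide (f a = f b)) (l : List α) :
    (l.splitBy r).length = runs (l.map f) := by
  cases l with
  | nil => rfl
  | cons a l => simpa [List.splitBy] using length_splitBy_loop hr l a [] []

theorem eq_getLast_of_mem_splitBy (hr : ∀ a b, r a b = decide (f a = f b)) {l B : List α}
    (hB : B ∈ l.splitBy r) {c : α} (hc : c ∈ B) :
    f c = f (B.getLast (List.ne_nil_of_mem hc)) := by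
  have hchain : B.IsChain fun a b => f a = f b :=
    (List.isChain_of_mem_splitBy hB).imp fun a b hab => by simpa [hr] using hab
  have : IsTrans α fun a b => f a = f b := ⟨fun _ _ _ => Eq.trans⟩
  obtain rfl | ⟨B, b, rfl⟩ := B.eq_nil_or_concat'
  · simp at hc
  · have hpair := List.pairwise_append.1 hchain.pairwise
    simp only [List.mem_append, List.mem_singleton] at hc
    rw [List.getLast_append_singleton]
    rcases hc with hc | rfl
    · exact hpair.2.2 c hc b (List.mem_singleton_self b)
    · rfl

theorem getLast?_splitBy_iff (hr : ∀ a b, r a b = decide (f a = f b)) (l : List α) (t : Bool) :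
    (∃ B ∈ (l.splitBy r).getLast?, ∀ c ∈ B, f c = t) ↔ (l.map f).getLast? = some t := by
  obtain rfl | hl := eq_or_ne l []
  · simp
  have hsplit := List.splitBy_ne_nil (r := r).2 hl
  have hB := List.getLast_mem hsplit
  have hne := List.ne_nil_of_mem_splitBy hB
  rw [List.getLast?_eq_some_getLast hsplit, List.getLast?_map, List.getLast?_eq_some_getLast hl,
    ← List.getLast_getLast_splitBy r hl]
  simp only [Option.mem_some_iff, exists_eq_left', Option.map_some, Option.some.injEq]
  refine ⟨fun h => h _ (List.getLast_mem hne), fun h c hc => ?_⟩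
  rw [eq_getLast_of_mem_splitBy hr hB hc, h]

end splitBy

section parityBlocks

variable {n : ℕ} (p : n.Partition)

theorem decide_sameParity (c c' : ℕ × ℕ) :
    decide (SameParity c c') = decide (decide (c.2 < c.1) = decide (c'.2 < c'.1)) := by
  simp only [decide_eq_decide]
  omega

theorem signs_frobenius :
    signs false (frobenius p).unzip.1 (frobenius p).unzip.2 =
      (frobenius p).map fun c => decide (c.2 < c.1) := by
  rw [signs_eq_map_zip false (by simp), List.zip_unzip]
  rfl

theorem length_parityBlocks :
    (parityBlocks p).length =
      runs (signs false (frobenius p).unzip.1 (frobenius p).unzip.2) := by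
  rw [signs_frobenius, ← length_splitBy decide_sameParity, parityBlocks]

theorem lastBlockPositive_iff :
    LastBlockPositive p ↔
      (signs false (frobenius p).unzip.1 (frobenius p).unzip.2).getLast? = some true := by
  have hpos (c : ℕ × ℕ) : IsPositive c ↔ decide (c.2 < c.1) = true := by
    rw [decide_eq_true_eq]
    omega
  simp only [signs_frobenius, ← getLast?_splitBy_iff decide_sameParity, LastBlockPositive,
    parityBlocks, hpos]

theorem lastBlockNegative_iff :
    LastBlockNegative p ↔
      (signs false (frobenius p).unzip.1 (frobenius p).unzip.2).getLast? = some false := by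
  have hneg (c : ℕ × ℕ) : IsNegative c ↔ decide (c.2 < c.1) = false := by
    rw [decide_eq_false_iff_not]
    omega
  simp only [signs_frobenius, ← getLast?_splitBy_iff decide_sameParity, LastBlockNegative,
    parityBlocks, hneg]

theorem parityBlocks_positive_iff (m : ℕ) :
    (parityBlocks p).length = m ∧ LastBlockPositive p ↔
      RunsEndingTrue false m (frobenius p).unzip.1 (frobenius p).unzip.2 := by
  rw [length_parityBlocks, lastBlockPositive_iff, RunsEndingTrue]

theorem parityBlocks_negative_iff (m : ℕ) :
    (parityBlocks p).length = m ∧ LastBlockNegative p ↔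
      RunsEndingTrue true m (frobenius p).unzip.2 (frobenius p).unzip.1 := by
  rw [length_parityBlocks, lastBlockNegative_iff, RunsEndingTrue, signs_swap, runs_map_not,
    List.getLast?_map]
  simp [Option.map_eq_some_iff]

end parityBlocks

/-! ### Hooks and the Frobenius symbol -/

/-- The hook with corner `(i, i)`, arm length `a` and leg length `l`. -/
def hook (i a l : ℕ) : Finset (ℕ × ℕ) :=
  {i} ×ˢ Finset.Icc i (i + a) ∪ Finset.Ioc i (i + l) ×ˢ {i}

/-- The union of the first `d` diagonal hooks with arm lengths `x i` and leg lengths `y i`. -/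
def hooks (d : ℕ) (x y : ℕ → ℕ) : Finset (ℕ × ℕ) :=
  (Finset.range d).biUnion fun i => hook i (x i) (y i)

theorem card_hook (i a l : ℕ) : (hook i a l).card = a + l + 1 := by
  rw [hook, Finset.card_union_of_disjoint]
  · simp only [Finset.card_product, Finset.card_singleton, Nat.card_Icc, Nat.card_Ioc]
    omega
  · simp only [Finset.disjoint_left, Finset.mem_product, Finset.mem_singleton, Finset.mem_Ioc]
    omega

theorem min_eq_of_mem_hook {i a l : ℕ} {c : ℕ × ℕ} (hc : c ∈ hook i a l) : min c.1 c.2 = i := by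
  simp only [hook, Finset.mem_union, Finset.mem_product, Finset.mem_singleton, Finset.mem_Icc,
    Finset.mem_Ioc] at hc
  omega

theorem card_hooks (d : ℕ) (x y : ℕ → ℕ) :
    (hooks d x y).card = ∑ i ∈ Finset.range d, (x i + y i + 1) := by
  rw [hooks, Finset.card_biUnion]
  · simp only [card_hook]
  · intro i _ j _ hij
    refine Finset.disjoint_left.2 fun c hi hj => hij ?_
    rw [← min_eq_of_mem_hook hi, min_eq_of_mem_hook hj]

theorem mem_hooks {d : ℕ} {x y : ℕ → ℕ} {i j : ℕ} :
    (i, j) ∈ hooks d x y ↔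
      i ≤ j ∧ i < d ∧ j ≤ i + x i ∨ j < i ∧ j < d ∧ i ≤ j + y j := by
  simp only [hooks, hook, Finset.mem_biUnion, Finset.mem_range, Finset.mem_union,
    Finset.mem_product, Finset.mem_singleton, Finset.mem_Icc, Finset.mem_Ioc]
  constructor
  · rintro ⟨k, hk, ⟨rfl, h⟩ | ⟨h, rfl⟩⟩ <;> omega
  · rintro (h | h)
    · exact ⟨i, h.2.1, .inl ⟨rfl, h.1, h.2.2⟩⟩
    · exact ⟨j, h.2.1, .inr ⟨⟨h.1, h.2.2⟩, rfl⟩⟩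

theorem hooks_congr {d : ℕ} {x x' y y' : ℕ → ℕ} (hx : ∀ i < d, x i = x' i)
    (hy : ∀ i < d, y i = y' i) : hooks d x y = hooks d x' y' :=
  Finset.biUnion_congr rfl fun i hi => by
    rw [hx i (Finset.mem_range.1 hi), hy i (Finset.mem_range.1 hi)]

/-- The Young diagram `μ` has exactly `d` diagonal cells, i.e. its Durfee square has side `d`. -/
def HasDiag (μ : YoungDiagram) (d : ℕ) : Prop := ∀ i, (i, i) ∈ μ ↔ i < d

/-- The number of cells of `μ` to the right of `(i, i)`, if this is a cell of `μ`. -/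
def arm (μ : YoungDiagram) (i : ℕ) : ℕ := μ.rowLen i - (i + 1)

/-- The number of cells of `μ` below `(i, i)`, if this is a cell of `μ`. -/
def leg (μ : YoungDiagram) (i : ℕ) : ℕ := μ.colLen i - (i + 1)

section HasDiag

variable {μ : YoungDiagram} {d : ℕ}

theorem HasDiag.unique {e : ℕ} (hd : HasDiag μ d) (he : HasDiag μ e) : d = e :=
  eq_of_forall_lt_iff fun i => (hd i).symm.trans (he i)

theorem HasDiag.rowLen_eq (h : HasDiag μ d) {i : ℕ} (hi : i < d) :
    μ.rowLen i = i + arm μ i + 1 := by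
  have := YoungDiagram.mem_iff_lt_rowLen.1 ((h i).2 hi)
  rw [arm]
  omega

theorem HasDiag.colLen_eq (h : HasDiag μ d) {i : ℕ} (hi : i < d) :
    μ.colLen i = i + leg μ i + 1 := by
  have := YoungDiagram.mem_iff_lt_colLen.1 ((h i).2 hi)
  rw [leg]
  omega

theorem HasDiag.strictAntiOn_arm (h : HasDiag μ d) : StrictAntiOn (arm μ) (Set.Iio d) := by
  intro i hi j hj hij
  have := μ.rowLen_anti i j hij.le
  rw [h.rowLen_eq hi, h.rowLen_eq hj] at this
  omega

theorem HasDiag.strictAntiOn_leg (h : HasDiag μ d) : StrictAntiOn (leg μ) (Set.Iio d) := by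
  intro i hi j hj hij
  have := μ.colLen_anti i j hij.le
  rw [h.colLen_eq hi, h.colLen_eq hj] at this
  omega

theorem HasDiag.cells_eq_hooks (h : HasDiag μ d) : μ.cells = hooks d (arm μ) (leg μ) := by
  ext ⟨i, j⟩
  rw [YoungDiagram.mem_cells, mem_hooks]
  have hdiag : (i, j) ∈ μ → min i j < d := fun hij =>
    (h _).1 (μ.up_left_mem (min_le_left i j) (min_le_right i j) hij)
  have hrow (hi : i < d) : (i, j) ∈ μ ↔ j < i + arm μ i + 1 := by
    rw [YoungDiagram.mem_iff_lt_rowLen, h.rowLen_eq hi]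
  have hcol (hj : j < d) : (i, j) ∈ μ ↔ i < j + leg μ j + 1 := by
    rw [YoungDiagram.mem_iff_lt_colLen, h.colLen_eq hj]
  grind

theorem HasDiag.card_eq (h : HasDiag μ d) :
    μ.card = ∑ i ∈ Finset.range d, (arm μ i + leg μ i + 1) := by
  rw [YoungDiagram.card, h.cells_eq_hooks, card_hooks]

theorem add_le_of_strictAntiOn {x : ℕ → ℕ} (hx : StrictAntiOn x (Set.Iio d)) {i j : ℕ}
    (hij : i ≤ j) (hj : j < d) : j + x j ≤ i + x i := by
  induction j, hij using Nat.le_induction with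
  | base => rfl
  | succ j _ ih =>
    have := hx (Set.mem_Iio.2 (j.lt_succ_self.trans hj)) hj j.lt_succ_self
    have := ih (j.lt_succ_self.trans hj)
    omega

theorem isLowerSet_hooks {x y : ℕ → ℕ} (hx : StrictAntiOn x (Set.Iio d))
    (hy : StrictAntiOn y (Set.Iio d)) : IsLowerSet (hooks d x y : Set (ℕ × ℕ)) := by
  rintro ⟨i, j⟩ ⟨i', j'⟩ ⟨hi, hj⟩ hij
  rw [Finset.mem_coe, mem_hooks] at hij ⊢
  simp only at hi hj
  have hx' (k : ℕ) := @add_le_of_strictAntiOn d x hx i' k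
  have hy' (k : ℕ) := @add_le_of_strictAntiOn d y hy j' k
  rcases hij with hij | hij
  · have := hx' i
    have := hy' i
    omega
  · have := hx' j
    have := hy' j
    omega

theorem exists_hasDiag_arm_leg {x y : ℕ → ℕ} (hx : StrictAntiOn x (Set.Iio d))
    (hy : StrictAntiOn y (Set.Iio d)) :
    ∃ μ, HasDiag μ d ∧ (∀ i < d, arm μ i = x i) ∧ ∀ i < d, leg μ i = y i := by
  let μ : YoungDiagram := ⟨hooks d x y, isLowerSet_hooks hx hy⟩
  have hmem (i j : ℕ) : (i, j) ∈ μ ↔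
      i ≤ j ∧ i < d ∧ j ≤ i + x i ∨ j < i ∧ j < d ∧ i ≤ j + y j := mem_hooks
  have hrow (i : ℕ) (hi : i < d) : μ.rowLen i = i + x i + 1 := by
    refine eq_of_forall_lt_iff fun j => ?_
    have := @add_le_of_strictAntiOn d y hy j i
    rw [← YoungDiagram.mem_iff_lt_rowLen, hmem]
    omega
  have hcol (j : ℕ) (hj : j < d) : μ.colLen j = j + y j + 1 := by
    refine eq_of_forall_lt_iff fun i => ?_
    have := @add_le_of_strictAntiOn d x hx i j
    rw [← YoungDiagram.mem_iff_lt_colLen, hmem]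
    omega
  refine ⟨μ, fun i => ?_, fun i hi => ?_, fun i hi => ?_⟩
  · rw [hmem]
    omega
  · rw [arm, hrow i hi]
    omega
  · rw [leg, hcol i hi]
    omega

end HasDiag

/-- The Frobenius symbol of a Young diagram with `d` diagonal cells, as a pair of rows. -/
def frobeniusRows (d : ℕ) (μ : YoungDiagram) : List ℕ × List ℕ :=
  ((List.range d).map (arm μ), (List.range d).map (leg μ))

section frobeniusRows

variable {d : ℕ}

theorem sortedGT_map_range {x : ℕ → ℕ} :
    ((List.range d).map x).SortedGT ↔ StrictAntiOn x (Set.Iio d) := by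
  rw [List.sortedGT_iff_getElem_gt_getElem_of_lt]
  simp only [List.length_map, List.length_range, List.getElem_map, List.getElem_range]
  exact ⟨fun h i hi j hj => @h j i hj hi, fun h i j hi hj => h hj hi⟩

theorem exists_eq_map_range {l : List ℕ} (h : l.length = d) :
    ∃ x : ℕ → ℕ, l = (List.range d).map x := by
  refine ⟨fun i => l.getD i 0, List.ext_getElem (by simpa using h) fun i hi _ => ?_⟩
  simp [hi]

theorem HasDiag.card_eq_totalSum {μ : YoungDiagram} (h : HasDiag μ d) :
    μ.card = totalSum (frobeniusRows d μ) + d := by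
  have hsum (x : ℕ → ℕ) : ((List.range d).map x).sum = ∑ i ∈ Finset.range d, x i := rfl
  simp [h.card_eq, totalSum, frobeniusRows, hsum, Finset.sum_add_distrib]

theorem bijOn_frobeniusRows (d : ℕ) (Q : List ℕ → List ℕ → Prop) :
    Set.BijOn (frobeniusRows d)
      {μ | HasDiag μ d ∧ Q (frobeniusRows d μ).1 (frobeniusRows d μ).2} (pairs d d Q) := by
  refine ⟨fun μ hμ => ?_, fun μ hμ ν hν h => ?_, ?_⟩
  · exact ⟨sortedGT_map_range.2 hμ.1.strictAntiOn_arm, sortedGT_map_range.2 hμ.1.strictAntiOn_leg,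
      by simp [frobeniusRows], by simp [frobeniusRows], hμ.2⟩
  · simp only [frobeniusRows, Prod.mk.injEq, List.map_inj_left, List.mem_range] at h
    exact YoungDiagram.ext (by rw [hμ.1.cells_eq_hooks, hν.1.cells_eq_hooks, hooks_congr h.1 h.2])
  · rintro ⟨xs, ys⟩ ⟨hx, hy, hxd, hyd, hQ⟩
    obtain ⟨x, rfl⟩ := exists_eq_map_range hxd
    obtain ⟨y, rfl⟩ := exists_eq_map_range hyd
    obtain ⟨μ, hμ, harm, hleg⟩ :=
      exists_hasDiag_arm_leg (sortedGT_map_range.1 hx) (sortedGT_map_range.1 hy)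
    have hrows : frobeniusRows d μ = ((List.range d).map x, (List.range d).map y) := by
      simpa only [frobeniusRows, Prod.mk.injEq, List.map_inj_left, List.mem_range] using
        ⟨harm, hleg⟩
    exact ⟨μ, ⟨hμ, hrows ▸ hQ⟩, hrows⟩

end frobeniusRows

/-- The Ferrers graph of a partition, as a Young diagram. -/
def diagram {n : ℕ} (p : n.Partition) : YoungDiagram :=
  .ofRowLens (p.parts.sort (· ≥ ·)) (p.parts.pairwise_sort (· ≥ ·)).sortedGE

section diagram

variable {n : ℕ} (p : n.Partition)

theorem mem_diagram (i j : ℕ) : (i, j) ∈ diagram p ↔ j < rowLength p i := by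
  rw [diagram, YoungDiagram.mem_ofRowLens, rowLength]
  by_cases hi : i < (p.parts.sort (· ≥ ·)).length
  · simp only [List.getD_eq_getElem _ _ hi, hi, exists_true_left]
  · simp only [List.getD_eq_default _ _ (not_lt.1 hi), hi, IsEmpty.exists_iff, not_lt_zero]

theorem rowLen_diagram (i : ℕ) : (diagram p).rowLen i = rowLength p i :=
  eq_of_forall_lt_iff fun j => by rw [← YoungDiagram.mem_iff_lt_rowLen, mem_diagram]

theorem rowLens_diagram : (diagram p).rowLens = p.parts.sort (· ≥ ·) :=
  YoungDiagram.rowLens_ofRowLens_eq_self fun _ hx => p.parts_pos ((Multiset.mem_sort _).1 hx)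

theorem coe_rowLens_diagram : ((diagram p).rowLens : Multiset ℕ) = p.parts := by
  rw [rowLens_diagram, Multiset.sort_eq]

theorem sum_rowLens (μ : YoungDiagram) : μ.rowLens.sum = μ.card := by
  have hfst : ∀ c ∈ μ.cells, c.1 ∈ Finset.range (μ.colLen 0) := fun c hc =>
    Finset.mem_range.2 (YoungDiagram.mem_iff_lt_colLen.1 (μ.up_left_mem le_rfl c.2.zero_le hc))
  rw [YoungDiagram.card, Finset.card_eq_sum_card_fiberwise hfst, YoungDiagram.rowLens]
  change ∑ i ∈ Finset.range (μ.colLen 0), μ.rowLen i = _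
  exact Finset.sum_congr rfl fun i _ => μ.rowLen_eq_card

theorem card_diagram : (diagram p).card = n := by
  rw [← sum_rowLens, ← Multiset.sum_coe, coe_rowLens_diagram, p.parts_sum]

theorem diagram_injective : Function.Injective (diagram (n := n)) := fun p q h =>
  Nat.Partition.ext (by rw [← coe_rowLens_diagram p, h, coe_rowLens_diagram])

theorem exists_diagram_eq (μ : YoungDiagram) : ∃ p : μ.card.Partition, diagram p = μ := by
  let p : μ.card.Partition :=
    ⟨μ.rowLens, fun hi => μ.pos_of_mem_rowLens _ (Multiset.mem_coe.1 hi), sum_rowLens μ⟩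
  have hsort : p.parts.sort (· ≥ ·) = μ.rowLens :=
    (Multiset.coe_sort _ _).trans
      (List.mergeSort_of_pairwise (by simpa using! μ.rowLens_sorted.pairwise))
  refine ⟨p, ?_⟩
  simp only [diagram, hsort, YoungDiagram.ofRowLens_to_rowLens_eq_self]

theorem countP_rowLens (μ : YoungDiagram) (j : ℕ) :
    μ.rowLens.countP (fun k => j < k) = μ.colLen j := by
  have hfilter : {i ∈ Finset.range (μ.colLen 0) | j < μ.rowLen i} = Finset.range (μ.colLen j) := by
    ext i
    have := μ.colLen_anti 0 j j.zero_le
    rw [Finset.mem_filter, Finset.mem_range, Finset.mem_range, ← YoungDiagram.mem_iff_lt_rowLen,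
      YoungDiagram.mem_iff_lt_colLen]
    omega
  rw [YoungDiagram.rowLens, List.countP_map, ← Finset.card_range (μ.colLen j), ← hfilter,
    ← Nat.count_eq_card_filter_range]
  rfl

theorem colLen_diagram (j : ℕ) : (diagram p).colLen j = colLength p j := by
  rw [← countP_rowLens, ← Multiset.coe_countP, coe_rowLens_diagram, colLength]

theorem exists_hasDiag (μ : YoungDiagram) : ∃ d, HasDiag μ d := by
  have hex : ∃ i, (i, i) ∉ μ := ⟨μ.rowLen 0, fun h => lt_irrefl _
    (YoungDiagram.mem_iff_lt_rowLen.1 (μ.up_left_mem (Nat.zero_le _) le_rfl h))⟩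
  refine ⟨Nat.find hex, fun i => ⟨fun h => ?_, fun h => not_not.1 (Nat.find_min hex h)⟩⟩
  by_contra! hi
  exact Nat.find_spec hex (μ.up_left_mem hi hi h)

theorem hasDiag_diagram : HasDiag (diagram p) (diagLength p) := by
  obtain ⟨d, hd⟩ := exists_hasDiag (diagram p)
  have hdn : d ≤ n := by
    rw [← card_diagram p, hd.card_eq_totalSum]
    exact Nat.le_add_left _ _
  have hfilter : {i ∈ Finset.range n | i < rowLength p i} = Finset.range d := by
    ext i
    rw [Finset.mem_filter, Finset.mem_range, Finset.mem_range, ← mem_diagram, hd i]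
    omega
  rwa [diagLength, hfilter, Finset.card_range]

theorem frobeniusRows_diagram :
    frobeniusRows (diagLength p) (diagram p) = (frobenius p).unzip := by
  simp [frobeniusRows, frobenius, List.unzip_eq_map, arm, leg, rowLen_diagram, colLen_diagram]

theorem length_frobenius_eq_iff {d : ℕ} :
    (frobenius p).length = d ↔ HasDiag (diagram p) d := by
  rw [frobenius, List.length_map, List.length_range]
  exact ⟨fun h => h ▸ hasDiag_diagram p, (hasDiag_diagram p).unique⟩

theorem mk_card_eq_genFun_card (D : Set YoungDiagram) (S : ∀ n : ℕ, Finset n.Partition)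
    (hS : ∀ n, ∀ p : n.Partition, p ∈ S n ↔ diagram p ∈ D) :
    mk (fun n => ((S n).card : ℚ)) = genFun YoungDiagram.card D := by
  ext n
  have himage : {μ ∈ D | μ.card = n} = diagram '' (S n : Set n.Partition) := by
    ext μ
    constructor
    · rintro ⟨hμ, rfl⟩
      obtain ⟨p, hp⟩ := exists_diagram_eq μ
      exact ⟨p, (hS _ p).2 (hp.symm ▸ hμ), hp⟩
    · rintro ⟨p, hp, rfl⟩
      exact ⟨(hS n p).1 hp, card_diagram p⟩
  rw [coeff_mk, genFun, coeff_mk, himage, diagram_injective.injOn.ncard_image,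
    Set.ncard_coe_finset]

theorem mk_card_eq_X_pow_mul_genPairs (d : ℕ) (Q : List ℕ → List ℕ → Prop)
    (S : ∀ n : ℕ, Finset n.Partition)
    (hS : ∀ n, ∀ p : n.Partition, p ∈ S n ↔
      (frobenius p).length = d ∧ Q (frobenius p).unzip.1 (frobenius p).unzip.2) :
    mk (fun n => ((S n).card : ℚ)) = X ^ d * genPairs d d Q := by
  rw [genPairs, ← genFun_of_bijOn (bijOn_frobeniusRows d Q) fun μ hμ => hμ.1.card_eq_totalSum]
  refine mk_card_eq_genFun_card _ S fun n p => ?_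
  rw [hS, length_frobenius_eq_iff]
  refine and_congr_right fun h => ?_
  rw [h.unique (hasDiag_diagram p), frobeniusRows_diagram]

end diagram

theorem mk_aPos (m d : ℕ) :
    mk (fun n => (aPos m d n : ℚ)) = X ^ d * genPairs d d (RunsEndingTrue false m) :=
  mk_card_eq_X_pow_mul_genPairs d _ _ fun n p => by
    rw [Finset.mem_filter, parityBlocks_positive_iff, and_iff_right (Finset.mem_univ p)]

theorem mk_aNeg (m d : ℕ) :
    mk (fun n => (aNeg m d n : ℚ)) = X ^ d * genPairs d d (RunsEndingTrue true m) := by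
  rw [genPairs_swap]
  exact mk_card_eq_X_pow_mul_genPairs d _ _ fun n p => by
    rw [Finset.mem_filter, parityBlocks_negative_iff, and_iff_right (Finset.mem_univ p)]

end ParityBlocks

theorem theorem1p1 (d m : ℕ) (hm : 1 ≤ m) (hmd : m ≤ d) :
    (PowerSeries.mk (fun n => (ParityBlocks.aPos m d n : ℚ)) =
      (PowerSeries.X : PowerSeries ℚ) ^ (d ^ 2 + d + m.choose 2) *
        (ParityBlocks.qPochhammer PowerSeries.X PowerSeries.X (2 * d))⁻¹ *
        ((1 - PowerSeries.X ^ m) * (1 - PowerSeries.X ^ d)⁻¹) *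
        ParityBlocks.qBinomial (2 * d) (d + m)) ∧
    (PowerSeries.mk (fun n => (ParityBlocks.aNeg m d n : ℚ)) =
      (PowerSeries.X : PowerSeries ℚ) ^ (d ^ 2 + m.choose 2) *
        (ParityBlocks.qPochhammer PowerSeries.X PowerSeries.X (2 * d))⁻¹ *
        ((1 - PowerSeries.X ^ m) * (1 - PowerSeries.X ^ d)⁻¹) *
        ParityBlocks.qBinomial (2 * d) (d + m)) := by
  have hd : d ≠ 0 := by omega
  have hm' : m ≠ 0 := by omega
  rw [ParityBlocks.mk_aPos, ParityBlocks.mk_aNeg,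
    ParityBlocks.X_pow_mul_genPairs_runsEndingTrue false hd hm',
    ParityBlocks.X_pow_mul_genPairs_runsEndingTrue true hd hm']
  simp
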